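/- There exist absolute constants $c_1,c_2>0$ such that the following holds for all positive integers $k\le p$ and $s\le m$ and every unitarily invariant norm $\|\cdot\|_\tau$ on $\mathbb R^{p\times m}$ (that is, every norm with $\|UAV\|_\tau=\|A\|_\tau$ for all $A\in\mathbb R^{p\times m}$ and all orthogonal $U\in O(p)$, $V\in O(m)$). Let $\tau(x)=\|\mathrm{diag}(x)\|_\tau$, $x\in\mathbb R^{p\wedge m}$, be the symmetric gauge function of the norm, where $\mathrm{diag}(x)$ is the $p\times m$ matrix with diagonal $x$ and zeros elsewhere. Let $r=k\wedge s$, let $\tau|_r(x_1,\dots,x_r)=\tau(x_1,\dots,x_r,0,\dots,0)$, and let $L_{\tau|_r}=\sup_{0\ne x\in\mathbb R^r}\tau|_r(x)/\|x\|_2$. Let $B_2=\{A\in\mathbb R^{p\times m}:\|A\|_F\le 1\}$ be the unit Frobenius ball and let $\mathcal F(k,s;p,m)$ be the set of all $A\in\mathbb R^{p\times m}$ with at most $k$ nonzero rows and at most $s$ nonzero columns. For a set $T$ and $\epsilon>0$ let $\mathcal M(T,\|\cdot\|_\tau,\epsilon)$ be the packing number of $T$, i.e. the maximal number of points of $T$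 whose pairwise $\|\cdot\|_\tau$-distances are all at least $\epsilon$. Then $\mathcal M\big(B_2\cap\mathcal F(k,s;p,m),\|\cdot\|_\tau,c_1L_{\tau|_r}\big)$ is finite and $$\log \mathcal M\big(B_2\cap\mathcal F(k,s;p,m),\|\cdot\|_\tau,c_1L_{\tau|_r}\big)\;\ge\; c_2\Big(k\log\frac{ep}{k}+s\log\frac{em}{s}\Big).$$ -/

import Mathlib

namespace SubmatrixPacking

/-- A seminorm `N` on real `p × m` matrices is a unitarily invariant norm if it is definite
(hence a norm) and `N (U A V) = N A` for all orthogonal `U`, `V`. -/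
structure IsUnitarilyInvariantNorm {p m : ℕ}
    (N : Seminorm ℝ (Matrix (Fin p) (Fin m) ℝ)) : Prop where
  eq_zero_of_map_eq_zero : ∀ A, N A = 0 → A = 0
  invariant : ∀ U ∈ Matrix.orthogonalGroup (Fin p) ℝ, ∀ V ∈ Matrix.orthogonalGroup (Fin m) ℝ,
    ∀ A, N (U * A * V) = N A

/-- The rectangular `p × m` diagonal matrix with diagonal entries `x`. -/
def rectDiag {p m : ℕ} (x : Fin (min p m) → ℝ) : Matrix (Fin p) (Fin m) ℝ :=
  Matrix.of fun i j =>
    if h : (i : ℕ) = (j : ℕ) then x ⟨i, lt_min i.isLt (h.symm ▸ j.isLt)⟩ else 0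

/-- The symmetric gauge function `τ` on `ℝ^(p ∧ m)` of a unitarily invariant norm `N`:
`τ(x) = N(diag(x))`. -/
def gauge {p m : ℕ} (N : Seminorm ℝ (Matrix (Fin p) (Fin m) ℝ)) (x : Fin (min p m) → ℝ) : ℝ :=
  N (rectDiag x)

/-- The restriction `τ|_r (x₁, …, x_r) = τ(x₁, …, x_r, 0, …, 0)`, used for `r ≤ d`. -/
def gaugeRestrict {d : ℕ} (τ : (Fin d → ℝ) → ℝ) (r : ℕ) (x : Fin r → ℝ) : ℝ :=
  τ fun i => if h : (i : ℕ) < r then x ⟨i, h⟩ else 0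

/-- The Lipschitz constant `sup_{x ≠ 0} τ(x) / ‖x‖₂` of a norm `τ` on `ℝ^d` with respect to the
Euclidean norm. For a norm `τ` the set is bounded above, so this is a genuine supremum. -/
noncomputable def lipschitzConst {d : ℕ} (τ : (Fin d → ℝ) → ℝ) : ℝ :=
  sSup {c : ℝ | ∃ x : Fin d → ℝ, x ≠ 0 ∧ c = τ x / ‖WithLp.toLp 2 x‖}

/-- The `p × m` matrices with at most `k` nonzero rows and at most `s` nonzero columns. -/
def submatrixSparse (k s p m : ℕ) : Set (Matrix (Fin p) (Fin m) ℝ) :=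
  {A | {i | A.row i ≠ 0}.ncard ≤ k ∧ {j | A.col j ≠ 0}.ncard ≤ s}

section Frobenius

attribute [local instance] Matrix.frobeniusNormedAddCommGroup

/-- The closed unit ball of the Frobenius norm. -/
def frobeniusUnitBall (p m : ℕ) : Set (Matrix (Fin p) (Fin m) ℝ) :=
  {A | ‖A‖ ≤ 1}

end Frobenius

/-- The `ε`-packing number of `T` with respect to the distance `ρ`: the maximal number of points
of `T` whose pairwise distances are all at least `ε` (`⊤` if there is no maximum). -/
noncomputable def packingNumber {α : Type*} (T : Set α) (ρ : α → α → ℝ) (ε : ℝ) : ℕ∞ :=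
  ⨆ F ∈ {F : Finset α | (F : Set α) ⊆ T ∧ (F : Set α).Pairwise fun a b => ε ≤ ρ a b},
    (F.card : ℕ∞)

end SubmatrixPacking

open Finset

namespace SubmatrixPacking

/-! ### A flat orthogonal matrix -/

/-! Let `x` be a Euclidean unit vector at which `τ|_r` attains its Lipschitz constant `L`. Then `L
x` is a subgradient: `L ⟨x, z⟩ ≤ τ|_r(z)`. For matrices with columns `x_l u_l` and `x_l u'_l`, where
`u` is orthonormal, rotate `u_l` to the `l`-th basis vector and pinch to the diagonal. Invariance
and the subgradient bound their distance below by `L ∑ x_l² (1 - ⟨u_l, u'_l⟩)`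
(`le_norm_sub_scaledColumns`).

It remains to find many sparse orthonormal frames that differ on average against the weights `x_l²`.
Cut `k * (p / k)` of the coordinates into `k` blocks and move each row of a flat orthogonal matrix,
with a free sign, to a free position in its block. Orthonormality survives, and frames that disagree
at row `b` contribute at least `w b = ∑ x_l² h_{bl}²`. Flatness gives `w b ≤ 2/k` while the weights
sum to 1, so at least `k/4` rows have `w b ≥ 1/(2k)`. A Gilbert–Varshamov code on those rows, over
the `2 (p / k)` choices of position and sign, gives the term `k log(ep/k)`; the signs keep the
alphabet nontrivial when `p / k = 1`. Transposition gives the term in `s`, and averaging the two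
bounds finishes. -/

theorem sum_exp_pow {k : ℕ} (hk : 1 ≤ k) (n : ℤ) :
    ∑ b : Fin k, Complex.exp (2 * Real.pi * Complex.I * n / k) ^ (b : ℕ) =
      if (k : ℤ) ∣ n then (k : ℂ) else 0 := by
  have hk0 : (k : ℂ) ≠ 0 := by exact_mod_cast (by lia : k ≠ 0)
  have hpi : (2 * Real.pi * Complex.I : ℂ) ≠ 0 := by simp [Real.pi_ne_zero]
  set ζ := Complex.exp (2 * Real.pi * Complex.I * n / k) with hζ
  have hpow : ζ ^ k = 1 := by
    rw [hζ, ← Complex.exp_nat_mul, Complex.exp_eq_one_iff]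
    exact ⟨n, by field_simp⟩
  have hone : ζ = 1 ↔ (k : ℤ) ∣ n := by
    rw [hζ, Complex.exp_eq_one_iff]
    constructor
    · rintro ⟨j, hj⟩
      refine ⟨j, ?_⟩
      have h : (n : ℂ) = k * j := by
        field_simp at hj
        exact hj
      exact_mod_cast h
    · rintro ⟨j, rfl⟩
      exact ⟨j, by push_cast; field_simp⟩
  rw [Fin.sum_univ_eq_sum_range (fun b => ζ ^ b)]
  split_ifs with h
  · simp [hone.2 h]
  · rw [geom_sum_eq (fun h' => h (hone.1 h')), hpow]
    simp

theorem sum_cos {k : ℕ} (hk : 1 ≤ k) (n : ℤ) :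
    ∑ b : Fin k, Real.cos (2 * Real.pi * n * (b : ℕ) / k) =
      if (k : ℤ) ∣ n then (k : ℝ) else 0 := by
  have h := congrArg Complex.re (sum_exp_pow hk n)
  rw [Complex.re_sum] at h
  rw [show (if (k : ℤ) ∣ n then (k : ℝ) else 0) =
    (if (k : ℤ) ∣ n then (k : ℂ) else 0).re by split_ifs <;> simp, ← h]
  refine Finset.sum_congr rfl fun b _ => ?_
  rw [← Complex.exp_nat_mul, ← Complex.exp_ofReal_mul_I_re]
  congr 2
  push_cast
  ring

theorem sum_sin {k : ℕ} (hk : 1 ≤ k) (n : ℤ) :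
    ∑ b : Fin k, Real.sin (2 * Real.pi * n * (b : ℕ) / k) = 0 := by
  have h := congrArg Complex.im (sum_exp_pow hk n)
  rw [Complex.im_sum] at h
  rw [show (0 : ℝ) = (if (k : ℤ) ∣ n then (k : ℂ) else 0).im by split_ifs <;> simp, ← h]
  refine Finset.sum_congr rfl fun b _ => ?_
  rw [← Complex.exp_nat_mul, ← Complex.exp_ofReal_mul_I_im]
  congr 2
  push_cast
  ring

/-- The discrete Hartley matrix of order `k`. -/
noncomputable def hartley (k : ℕ) (b l : Fin k) : ℝ :=
  (Real.cos (2 * Real.pi * (l : ℕ) * (b : ℕ) / k) +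
    Real.sin (2 * Real.pi * (l : ℕ) * (b : ℕ) / k)) / √k

/-- Flatness, from `(cos + sin)² ≤ 2`: no single row can carry much of the weight. -/
theorem hartley_sq_le {k : ℕ} (b l : Fin k) : hartley k b l ^ 2 ≤ 2 / k := by
  rw [hartley, div_pow, Real.sq_sqrt (Nat.cast_nonneg k)]
  gcongr
  have h := Real.sin_sq_add_cos_sq (2 * Real.pi * (l : ℕ) * (b : ℕ) / k)
  set c := Real.cos (2 * Real.pi * (l : ℕ) * (b : ℕ) / k)
  set d := Real.sin (2 * Real.pi * (l : ℕ) * (b : ℕ) / k)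
  nlinarith [sq_nonneg (c - d)]

/-- The product of two entries is `cos` of the difference of the angles plus `sin` of their sum,
over `k`; the sine sums vanish, and the cosine sum vanishes unless `k ∣ l - l'`. -/
theorem sum_hartley_mul {k : ℕ} (l l' : Fin k) :
    ∑ b, hartley k b l * hartley k b l' = if l = l' then 1 else 0 := by
  have hk : 1 ≤ k := by have := l.isLt; lia
  have hk0 : (k : ℝ) ≠ 0 := by exact_mod_cast (by lia : k ≠ 0)
  have key : ∀ b : Fin k, hartley k b l * hartley k b l' =
      (Real.cos (2 * Real.pi * ((l : ℤ) - (l' : ℤ) : ℤ) * (b : ℕ) / k) +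
        Real.sin (2 * Real.pi * ((l : ℤ) + (l' : ℤ) : ℤ) * (b : ℕ) / k)) / k := by
    intro b
    rw [hartley, hartley, div_mul_div_comm, Real.mul_self_sqrt (Nat.cast_nonneg k)]
    congr 1
    rw [show 2 * Real.pi * (((l : ℤ) - (l' : ℤ) : ℤ) : ℝ) * (b : ℕ) / k =
        2 * Real.pi * (l : ℕ) * (b : ℕ) / k - 2 * Real.pi * (l' : ℕ) * (b : ℕ) / k by
          push_cast; ring,
      show 2 * Real.pi * (((l : ℤ) + (l' : ℤ) : ℤ) : ℝ) * (b : ℕ) / k =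
        2 * Real.pi * (l : ℕ) * (b : ℕ) / k + 2 * Real.pi * (l' : ℕ) * (b : ℕ) / k by
          push_cast; ring, Real.cos_sub, Real.sin_add]
    ring
  simp_rw [key]
  rw [← Finset.sum_div, Finset.sum_add_distrib, sum_cos hk, sum_sin hk, add_zero]
  have hdvd : (k : ℤ) ∣ ((l : ℤ) - (l' : ℤ)) ↔ l = l' := by
    constructor
    · intro h
      have h1 := l.isLt
      have h2 := l'.isLt
      have h3 : ((l : ℕ) : ℤ) < k := Nat.cast_lt.2 h1
      have h4 : ((l' : ℕ) : ℤ) < k := Nat.cast_lt.2 h2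
      have := Int.eq_zero_of_abs_lt_dvd h (by
        rw [abs_lt]
        constructor <;> linarith [Int.natCast_nonneg (l : ℕ), Int.natCast_nonneg (l' : ℕ)])
      ext
      lia
    · rintro rfl
      simp
  simp only [hdvd]
  split_ifs <;> simp [hk0]

/-! ### A Gilbert–Varshamov bound -/

section Code

variable {ι α : Type*} [Fintype ι] [DecidableEq ι] [Fintype α] [DecidableEq α]

theorem sum_pow_hammingDist (f : ι → α) (t : ℝ) :
    ∑ g : ι → α, t ^ hammingDist f g = (1 + (Fintype.card α - 1) * t) ^ Fintype.card ι := by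
  have h : ∀ g : ι → α, t ^ hammingDist f g = ∏ i, if f i ≠ g i then t else 1 := by
    intro g
    rw [Finset.prod_ite]
    simp [hammingDist]
  simp_rw [h]
  rw [← Fintype.prod_sum (fun i a => if f i ≠ a then t else 1)]
  have h2 : ∀ i, ∑ a, (if f i ≠ a then t else 1) = 1 + (Fintype.card α - 1) * t := by
    intro i
    rw [← Finset.add_sum_erase _ _ (Finset.mem_univ (f i))]
    rw [Finset.sum_congr rfl (g := fun _ => t)
      (fun a ha => by simp [(Finset.ne_of_mem_erase ha).symm])]
    simp [Finset.card_erase_of_mem, Nat.cast_sub (Fintype.card_pos_iff.2 ⟨f i⟩)]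
  rw [Finset.prod_congr rfl fun i _ => h2 i, Finset.prod_const, Finset.card_univ]

/-- Volume bound for Hamming balls of relative radius `1/10`. -/
theorem card_hamming_ball_le (hα : 2 ≤ Fintype.card α) (f : ι → α) :
    ((univ.filter fun g : ι → α => 10 * hammingDist f g < Fintype.card ι).card : ℝ) ^ 5 ≤
      (Fintype.card α : ℝ) ^ (4 * Fintype.card ι) := by
  set n := Fintype.card ι
  set Q : ℝ := (Fintype.card α : ℝ) with hQ
  set V := (univ.filter fun g : ι → α => 10 * hammingDist f g < n)
  have hQ2 : 2 ≤ Q := by rw [hQ]; exact_mod_cast hα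
  have hQ0 : 0 < Q := by linarith
  -- Exponential-moment bound: this `t` keeps the factor `1 + (Q - 1) t` below `3/2`.
  set t : ℝ := 1 / (2 * Q) with ht
  have ht0 : 0 < t := by positivity
  have ht1 : t ≤ 1 := by rw [ht, div_le_one (by positivity)]; linarith
  have h1 : (V.card : ℝ) * t ^ (n / 10) ≤ (3 / 2) ^ n := by
    calc (V.card : ℝ) * t ^ (n / 10) = ∑ g ∈ V, t ^ (n / 10) := by simp
      _ ≤ ∑ g ∈ V, t ^ hammingDist f g := by
        refine Finset.sum_le_sum fun g hg => pow_le_pow_of_le_one ht0.le ht1 ?_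
        have := (Finset.mem_filter.1 hg).2
        lia
      _ ≤ ∑ g, t ^ hammingDist f g :=
        Finset.sum_le_sum_of_subset_of_nonneg (Finset.subset_univ _) fun _ _ _ => by positivity
      _ = (1 + (Q - 1) * t) ^ n := sum_pow_hammingDist f t
      _ ≤ (3 / 2) ^ n := by
        have h : (Q - 1) * t ≤ 1 / 2 := by
          rw [ht, mul_one_div, div_le_div_iff₀ (by positivity) (by norm_num)]
          linarith
        refine pow_le_pow_left₀ ?_ (by linarith) n
        have : 0 ≤ (Q - 1) * t := mul_nonneg (by linarith) ht0.le
        linarith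
  have h2 : (V.card : ℝ) ≤ (3 / 2) ^ n * (2 * Q) ^ (n / 10) := by
    have h3 : t ^ (n / 10) * (2 * Q) ^ (n / 10) = 1 := by
      rw [← mul_pow, ht, one_div_mul_cancel (by positivity), one_pow]
    calc (V.card : ℝ) = V.card * t ^ (n / 10) * (2 * Q) ^ (n / 10) := by
          rw [mul_assoc, h3, mul_one]
      _ ≤ _ := by gcongr
  -- The tenth power clears the floor in `n / 10`; then `2 (3/2)^10 ≤ 2^7 ≤ Q^7`.
  have h4 : ((V.card : ℝ) ^ 5) ^ 2 ≤ (Q ^ (4 * n)) ^ 2 := by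
    calc ((V.card : ℝ) ^ 5) ^ 2 = (V.card : ℝ) ^ 10 := by ring
      _ ≤ ((3 / 2) ^ n * (2 * Q) ^ (n / 10)) ^ 10 := by gcongr
      _ = ((3 / 2) ^ 10) ^ n * (2 * Q) ^ (n / 10 * 10) := by
        rw [mul_pow, ← pow_mul, ← pow_mul, ← pow_mul, mul_comm n 10]
      _ ≤ ((3 / 2) ^ 10) ^ n * (2 * Q) ^ n := by
        gcongr
        · linarith
        · exact Nat.div_mul_le_self n 10
      _ = ((3 / 2) ^ 10 * (2 * Q)) ^ n := (mul_pow _ _ _).symm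
      _ ≤ (Q ^ 8) ^ n := by
        have h7 : (2 : ℝ) ^ 7 ≤ Q ^ 7 := by gcongr
        refine pow_le_pow_left₀ (by positivity) ?_ n
        calc (3 / 2 : ℝ) ^ 10 * (2 * Q) ≤ 2 ^ 7 * Q := by nlinarith
          _ ≤ Q ^ 7 * Q := by gcongr
          _ = Q ^ 8 := by ring
      _ = _ := by rw [← pow_mul, ← pow_mul]; congr 1; ring
  exact (pow_le_pow_iff_left₀ (by positivity) (by positivity) (by norm_num)).1 h4

/-- The Gilbert–Varshamov bound at relative distance `1/10`. -/
theorem exists_code (hα : 2 ≤ Fintype.card α) :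
    ∃ C : Finset (ι → α),
      (∀ f ∈ C, ∀ g ∈ C, f ≠ g → Fintype.card ι ≤ 10 * hammingDist f g) ∧
      (Fintype.card α : ℝ) ^ Fintype.card ι ≤ (C.card : ℝ) ^ 5 := by
  set n := Fintype.card ι with hn
  let P : Finset (ι → α) → Prop := fun C =>
    ∀ f ∈ C, ∀ g ∈ C, f ≠ g → n ≤ 10 * hammingDist f g
  obtain ⟨C, hC⟩ : ∃ C, Maximal P C :=
    (Set.toFinite {C | P C}).exists_maximal ⟨∅, by intro f hf; simp at hf⟩
  refine ⟨C, hC.prop, ?_⟩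
  let ball : (ι → α) → Finset (ι → α) := fun f =>
    univ.filter fun g => 10 * hammingDist f g < n
  have hne : 0 < n ∨ n = 0 := by lia
  rcases hne with hn0 | hn0
  swap
  -- For an empty index set the strict balls are empty and cannot cover, so this case is separate.
  · have hCne : C.Nonempty := by
      by_contra h
      rw [Finset.not_nonempty_iff_eq_empty] at h
      have hι : IsEmpty ι := Fintype.card_eq_zero_iff.1 (hn ▸ hn0)
      have := hC.le_of_ge (y := {fun i => hι.elim i}) (by intro f hf g hg; lia) (by simp [h])
      rw [h] at this
      simp at this
    rw [hn0, pow_zero]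
    exact one_le_pow₀ (by exact_mod_cast hCne.card_pos)
  -- An uncovered word could be added to the code, against maximality.
  have hcover : (univ : Finset (ι → α)) ⊆ C.biUnion ball := by
    intro g _
    by_contra hg
    simp only [ball, Finset.mem_biUnion, Finset.mem_filter, Finset.mem_univ, true_and, not_exists,
      not_and, not_lt] at hg
    have hins : P (insert g C) := by
      intro f hf f' hf' hff
      rcases Finset.mem_insert.1 hf with h | h <;> rcases Finset.mem_insert.1 hf' with h' | h'
      · exact absurd (h.trans h'.symm) hff
      · rw [h, hammingDist_comm]; exact hg f' h'
      · rw [h']; exact hg f h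
      · exact hC.prop f h f' h' hff
    have := hC.le_of_ge hins (Finset.subset_insert _ _)
    have hgC := this (Finset.mem_insert_self g C)
    have := hg g hgC
    simp at this
    lia
  set Q : ℝ := (Fintype.card α : ℝ) with hQ
  have hQ2 : 2 ≤ Q := by rw [hQ]; exact_mod_cast hα
  have hQ0 : 0 < Q := by linarith
  have hcard : Q ^ n ≤ ∑ f ∈ C, ((ball f).card : ℝ) := by
    have h := (Finset.card_le_card hcover).trans Finset.card_biUnion_le
    rw [Finset.card_univ, Fintype.card_fun] at h
    rw [hQ, ← Nat.cast_sum]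
    exact_mod_cast h
  have hsum : ∃ v : ℝ, 0 ≤ v ∧ v ^ 5 ≤ Q ^ (4 * n) ∧ Q ^ n ≤ C.card * v := by
    have hCne : C.Nonempty := by
      by_contra h
      rw [Finset.not_nonempty_iff_eq_empty] at h
      rw [h, Finset.sum_empty] at hcard
      exact absurd hcard (not_le.2 (by positivity))
    obtain ⟨f, _, hf⟩ := Finset.exists_max_image C (fun f => ((ball f).card : ℝ)) hCne
    refine ⟨(ball f).card, by positivity, card_hamming_ball_le hα f, hcard.trans ?_⟩
    simpa using Finset.sum_le_card_nsmul C _ _ hf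
  obtain ⟨v, hv0, hv, hCv⟩ := hsum
  have h5 : Q ^ n * Q ^ (4 * n) ≤ (C.card : ℝ) ^ 5 * Q ^ (4 * n) := by
    calc Q ^ n * Q ^ (4 * n) = (Q ^ n) ^ 5 := by rw [← pow_add, ← pow_mul]; congr 1; ring
      _ ≤ (C.card * v) ^ 5 := by gcongr
      _ = (C.card : ℝ) ^ 5 * v ^ 5 := mul_pow _ _ _
      _ ≤ _ := by gcongr
  exact le_of_mul_le_mul_right h5 (by positivity)

end Code

/-! ### Norms on finite-dimensional spaces -/

theorem continuous_seminorm {E : Type*} [NormedAddCommGroup E] [NormedSpace ℝ E]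
    [FiniteDimensional ℝ E] (q : Seminorm ℝ E) : Continuous q :=
  continuousOn_univ.1 (q.convexOn.continuousOn isOpen_univ)

/-- The Lipschitz constant of a seminorm is attained at a unit vector. -/
theorem exists_lipschitzConst_maximizer {r : ℕ} (hr : 1 ≤ r) (q : Seminorm ℝ (Fin r → ℝ)) :
    ∃ x : Fin r → ℝ, ∑ i, x i ^ 2 = 1 ∧ q x = lipschitzConst q ∧
      ∀ z, q z ≤ lipschitzConst q * √(∑ i, z i ^ 2) := by
  have hnorm : ∀ z : Fin r → ℝ, ‖WithLp.toLp 2 z‖ = √(∑ i, z i ^ 2) := fun z => by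
    simp [EuclideanSpace.norm_eq]
  let i₀ : Fin r := ⟨0, hr⟩
  have hcont : Continuous q := continuous_seminorm q
  have hcomp : IsCompact (Metric.sphere (0 : EuclideanSpace ℝ (Fin r)) 1) := isCompact_sphere 0 1
  obtain ⟨y, hy, hmax⟩ := hcomp.exists_isMaxOn ⟨EuclideanSpace.single i₀ 1, by simp⟩
    (f := fun y => q y.ofLp) (hcont.comp (PiLp.continuous_ofLp 2 _)).continuousOn
  have hy1 : ‖y‖ = 1 := by simpa using hy
  have hle : ∀ z : Fin r → ℝ, q z ≤ q y.ofLp * ‖WithLp.toLp 2 z‖ := by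
    intro z
    by_cases hz : z = 0
    · simp [hz]
    have hpos : 0 < ‖WithLp.toLp 2 z‖ := by simpa using hz
    have h := hmax (a := ‖WithLp.toLp 2 z‖⁻¹ • WithLp.toLp 2 z) (by
      simp [norm_smul, hpos.ne'])
    simp only [Set.mem_ofPred_eq, WithLp.ofLp_smul, map_smul_eq_mul, norm_inv, norm_norm] at h
    rwa [inv_mul_le_iff₀ hpos, mul_comm] at h
  have hy0 : y.ofLp ≠ 0 := by
    rintro h
    have : y = 0 := by ext i; simp [h]
    simp [this] at hy1
  have hL : lipschitzConst q = q y.ofLp := by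
    refine IsGreatest.csSup_eq ⟨⟨y.ofLp, hy0, by simp [hy1]⟩, ?_⟩
    rintro c ⟨x, hx, rfl⟩
    have hpos : 0 < ‖WithLp.toLp 2 x‖ := by simpa using hx
    rw [div_le_iff₀ hpos]
    exact hle x
  refine ⟨y.ofLp, ?_, hL.symm, fun z => ?_⟩
  · rw [← EuclideanSpace.real_norm_sq_eq, hy1, one_pow]
  · rw [hL, ← hnorm]
    exact hle z

/-- At a Euclidean-unit maximizer `x` of `q`, the vector `L x` is a subgradient of `q`. -/
theorem mul_dot_le_of_maximizer {r : ℕ} (q : Seminorm ℝ (Fin r → ℝ)) {L : ℝ} {x : Fin r → ℝ}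
    (hx : ∑ i, x i ^ 2 = 1) (hqx : q x = L) (hq : ∀ z, q z ≤ L * √(∑ i, z i ^ 2))
    (z : Fin r → ℝ) : L * ∑ i, x i * z i ≤ q z := by
  have hL : 0 ≤ L := hqx ▸ apply_nonneg q x
  set S := ∑ i, z i ^ 2
  have hS : 0 ≤ S := Finset.sum_nonneg fun _ _ => sq_nonneg _
  -- First-order comparison of `q x = L` with `q (x - t z)`, using `√y ≤ (1 + y) / 2`; the error
  -- term vanishes as `t → 0`.
  have key : ∀ t : ℝ, 0 < t → L * ∑ i, x i * z i ≤ q z + t * (L * S / 2) := by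
    intro t ht
    have h1 : q x ≤ q (x - t • z) + t * q z := by
      calc q x = q ((x - t • z) + t • z) := by rw [sub_add_cancel]
        _ ≤ q (x - t • z) + q (t • z) := map_add_le_add q _ _
        _ = _ := by rw [map_smul_eq_mul, Real.norm_of_nonneg ht.le]
    have h2 : ∑ i, (x - t • z) i ^ 2 = 1 - 2 * t * ∑ i, x i * z i + t ^ 2 * S := by
      rw [← hx, Finset.mul_sum, Finset.mul_sum, ← Finset.sum_sub_distrib,
        ← Finset.sum_add_distrib]
      refine Finset.sum_congr rfl fun i _ => ?_
      simp only [Pi.sub_apply, Pi.smul_apply, smul_eq_mul]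
      ring
    have h3 : √(∑ i, (x - t • z) i ^ 2) ≤ 1 - t * ∑ i, x i * z i + t ^ 2 * S / 2 := by
      have h0 : 0 ≤ ∑ i, (x - t • z) i ^ 2 := Finset.sum_nonneg fun _ _ => sq_nonneg _
      have hs := Real.sq_sqrt h0
      nlinarith [sq_nonneg (√(∑ i, (x - t • z) i ^ 2) - 1)]
    have h4 := (hq (x - t • z)).trans (mul_le_mul_of_nonneg_left h3 hL)
    rw [hqx] at h1
    have h5 : t * (L * ∑ i, x i * z i) ≤ t * (q z + t * (L * S / 2)) := by nlinarith
    exact le_of_mul_le_mul_left h5 ht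
  by_contra! hlt
  set d := L * ∑ i, x i * z i - q z
  have hd : 0 < d := sub_pos.2 hlt
  have hc : 0 ≤ L * S / 2 := by positivity
  have := key (d / (L * S / 2 + 1)) (by positivity)
  have h6 : d / (L * S / 2 + 1) * (L * S / 2) < d := by
    rw [div_mul_eq_mul_div, div_lt_iff₀ (by positivity)]
    nlinarith
  linarith

/-! ### Pinching -/

variable {p m : ℕ}

/-- The `p × m` matrix with diagonal `(x₁, …, x_r, 0, …, 0)`. -/
def cornerDiag (p m r : ℕ) : (Fin r → ℝ) →ₗ[ℝ] Matrix (Fin p) (Fin m) ℝ where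
  toFun x := Matrix.of fun i j =>
    if h : (i : ℕ) = (j : ℕ) ∧ (i : ℕ) < r then x ⟨i, h.2⟩ else 0
  map_add' x y := by
    ext i j
    simp only [Matrix.of_apply, Matrix.add_apply, Pi.add_apply]
    split_ifs <;> simp
  map_smul' c x := by
    ext i j
    simp only [Matrix.of_apply, Matrix.smul_apply, Pi.smul_apply]
    split_ifs <;> simp

theorem cornerDiag_apply {r : ℕ} (x : Fin r → ℝ) (i : Fin p) (j : Fin m) :
    cornerDiag p m r x i j = if h : (i : ℕ) = (j : ℕ) ∧ (i : ℕ) < r then x ⟨i, h.2⟩ else 0 :=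
  rfl

/-- Exhibits the restricted gauge as a seminorm, so the subgradient argument applies to it. -/
theorem gaugeRestrict_gauge (N : Seminorm ℝ (Matrix (Fin p) (Fin m) ℝ)) (r : ℕ) :
    gaugeRestrict (gauge N) r = N.comp (cornerDiag p m r) := by
  ext x
  rw [gaugeRestrict, gauge, Seminorm.comp_apply]
  congr 1
  ext i j
  rw [cornerDiag_apply]
  simp only [rectDiag, Matrix.of_apply]
  by_cases h : (i : ℕ) = j <;> by_cases h' : (i : ℕ) < r <;> simp [h, h']

theorem transpose_cornerDiag {r : ℕ} (x : Fin r → ℝ) :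
    (cornerDiag p m r x).transpose = cornerDiag m p r x := by
  ext i j
  rw [Matrix.transpose_apply, cornerDiag_apply, cornerDiag_apply]
  by_cases h : (i : ℕ) = j
  · simp [h]
  · rw [dif_neg (by tauto), dif_neg (by tauto)]

/-- The diagonal matrix that flips the sign of coordinate `a`. -/
def signFlip (n a : ℕ) : Matrix (Fin n) (Fin n) ℝ :=
  Matrix.diagonal fun i => if (i : ℕ) = a then -1 else 1

theorem signFlip_mem (n a : ℕ) : signFlip n a ∈ Matrix.orthogonalGroup (Fin n) ℝ := by
  rw [Matrix.mem_orthogonalGroup_iff, signFlip, Matrix.diagonal_transpose,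
    Matrix.diagonal_mul_diagonal, ← Matrix.diagonal_one]
  congr 1
  ext i
  split_ifs <;> norm_num

/-- Averaging a matrix with its image under a sign flip of row `n` and column `n` deletes the
entries lying in exactly one of them, and cannot raise an invariant norm. Doing this for every index
leaves the diagonal. -/
theorem pinching_le {N : Seminorm ℝ (Matrix (Fin p) (Fin m) ℝ)}
    (hN : IsUnitarilyInvariantNorm N) (B : Matrix (Fin p) (Fin m) ℝ) :
    N (Matrix.of fun i j => if (i : ℕ) = (j : ℕ) then B i j else 0) ≤ N B := by
  have key : ∀ n : ℕ, N (Matrix.of fun i j =>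
      if ∀ a < n, ((i : ℕ) = a ↔ (j : ℕ) = a) then B i j else 0) ≤ N B := by
    intro n
    induction n with
    | zero => exact le_of_eq (congrArg N (by ext i j; simp))
    | succ n ih =>
      refine le_trans ?_ ih
      set C := (Matrix.of fun (i : Fin p) (j : Fin m) =>
        if ∀ a < n, ((i : ℕ) = a ↔ (j : ℕ) = a) then B i j else 0) with hC
      have hD : (Matrix.of fun (i : Fin p) (j : Fin m) =>
          if ∀ a < n + 1, ((i : ℕ) = a ↔ (j : ℕ) = a) then B i j else 0) =
          (1 / 2 : ℝ) • (C + signFlip p n * C * signFlip m n) := by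
        ext i j
        simp only [signFlip, Matrix.smul_apply, Matrix.add_apply, Matrix.mul_diagonal,
          Matrix.diagonal_mul, hC, Matrix.of_apply, Nat.forall_lt_succ_right, smul_eq_mul]
        by_cases h1 : ∀ a < n, ((i : ℕ) = a ↔ (j : ℕ) = a) <;>
        by_cases h2 : (i : ℕ) = n <;> by_cases h3 : (j : ℕ) = n <;>
        simp only [h1, h2, h3, if_true, iff_true, iff_false, not_true, and_true,
          and_false, not_false_eq_true, if_neg] <;> ring_nf
      rw [hD, map_smul_eq_mul, Real.norm_of_nonneg (by norm_num)]
      have := map_add_le_add N C (signFlip p n * C * signFlip m n)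
      rw [hN.invariant _ (signFlip_mem p n) _ (signFlip_mem m n)] at this
      linarith
  convert key (p + m) using 5 with i j
  refine if_congr ?_ rfl rfl
  constructor
  · intro h a _
    rw [h]
  · intro h
    exact ((h i (by lia)).1 rfl).symm

theorem sum_dite_lt {r : ℕ} (hrm : r ≤ m) (g : Fin r → ℝ) :
    ∑ j : Fin m, (if h : (j : ℕ) < r then g ⟨j, h⟩ else 0) = ∑ l, g l := by
  obtain ⟨d, rfl⟩ := Nat.exists_eq_add_of_le hrm
  rw [Fin.sum_univ_add]
  simp

/-- Definiteness enters here; it makes the packing radius positive, hence the packing number finite.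
-/
theorem lipschitzConst_pos {N : Seminorm ℝ (Matrix (Fin p) (Fin m) ℝ)}
    (hN : IsUnitarilyInvariantNorm N) {r : ℕ} (hr : 1 ≤ r) (hrp : r ≤ p) (hrm : r ≤ m) :
    0 < lipschitzConst (N.comp (cornerDiag p m r)) := by
  obtain ⟨x, hx, hqx, -⟩ := exists_lipschitzConst_maximizer hr (N.comp (cornerDiag p m r))
  rw [← hqx]
  refine lt_of_le_of_ne (apply_nonneg _ _) fun h => ?_
  have h0 := hN.eq_zero_of_map_eq_zero _ h.symm
  have hx0 : ∀ l, x l = 0 := fun l => by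
    have := congrFun (congrFun h0 ⟨l, by have := l.isLt; lia⟩) ⟨l, by have := l.isLt; lia⟩
    simpa [cornerDiag_apply] using this
  simp [hx0] at hx

/-- The `p × m` matrix with columns `x₁ u₁, …, x_r u_r, 0, …, 0`. -/
def scaledColumns (m : ℕ) {r : ℕ} (x : Fin r → ℝ) (u : Fin r → EuclideanSpace ℝ (Fin p)) :
    Matrix (Fin p) (Fin m) ℝ :=
  Matrix.of fun i j => if h : (j : ℕ) < r then x ⟨j, h⟩ * u ⟨j, h⟩ i else 0

theorem sum_sq_scaledColumns {r : ℕ} (hrm : r ≤ m) (x : Fin r → ℝ)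
    {u : Fin r → EuclideanSpace ℝ (Fin p)} (hu : Orthonormal ℝ u) :
    ∑ i, ∑ j, scaledColumns m x u i j ^ 2 = ∑ l, x l ^ 2 := by
  rw [Finset.sum_comm, ← sum_dite_lt hrm]
  refine Finset.sum_congr rfl fun j _ => ?_
  simp only [scaledColumns, Matrix.of_apply]
  split_ifs with h
  · simp_rw [mul_pow]
    rw [← Finset.mul_sum, ← EuclideanSpace.real_norm_sq_eq, hu.1, one_pow, mul_one]
  · simp

/-- The rows of `U` are an orthonormal basis completing `u`, so `U` sends `u_l` to the `l`-th basis
vector. -/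
theorem exists_orthogonal_extension {r : ℕ} {u : Fin r → EuclideanSpace ℝ (Fin p)}
    (hu : Orthonormal ℝ u) :
    ∃ U ∈ Matrix.orthogonalGroup (Fin p) ℝ,
      ∀ (i : Fin p) (h : (i : ℕ) < r) (a : Fin p), U i a = u ⟨i, h⟩ a := by
  let v : Fin p → EuclideanSpace ℝ (Fin p) := fun i => if h : (i : ℕ) < r then u ⟨i, h⟩ else 0
  have hv : Orthonormal ℝ ({i : Fin p | (i : ℕ) < r}.domRestrict v) := by
    have h := hu.comp (fun i : {i : Fin p | (i : ℕ) < r} => (⟨i.1, i.2⟩ : Fin r)) (by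
      intro i j hij
      simpa [Fin.ext_iff, Subtype.ext_iff] using hij)
    convert h using 1
    ext1 i
    have hi : ((i : Fin p) : ℕ) < r := i.2
    simp [Set.domRestrict, v, hi]
  obtain ⟨b, hb⟩ := hv.exists_orthonormalBasis_extension_of_card_eq (by simp)
  refine ⟨Matrix.of fun i a => b i a, ?_, fun i h a => ?_⟩
  · rw [Matrix.mem_orthogonalGroup_iff]
    ext i j
    have := orthonormal_iff_ite.1 b.orthonormal j i
    rw [PiLp.inner_apply] at this
    simp only [Matrix.mul_apply, Matrix.transpose_apply, Matrix.of_apply, Matrix.one_apply]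
    simpa [eq_comm] using this
  · rw [Matrix.of_apply, hb i h]
    simp [v, h]

/-- After the rotation taking `u_l` to the `l`-th basis vector, the difference has diagonal entries
`x_l (1 - ⟨u_l, u'_l⟩)`. Pinching discards the rest, and `hx` tests this diagonal against `x`. -/
theorem le_norm_sub_scaledColumns {N : Seminorm ℝ (Matrix (Fin p) (Fin m) ℝ)}
    (hN : IsUnitarilyInvariantNorm N) {r : ℕ} {L : ℝ} {x : Fin r → ℝ}
    (hx : ∀ z : Fin r → ℝ, L * ∑ i, x i * z i ≤ N (cornerDiag p m r z))
    {u u' : Fin r → EuclideanSpace ℝ (Fin p)} (hu : Orthonormal ℝ u) :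
    L * ∑ l, x l ^ 2 * (1 - inner ℝ (u l) (u' l)) ≤
      N (scaledColumns m x u - scaledColumns m x u') := by
  obtain ⟨U, hU, hUu⟩ := exists_orthogonal_extension hu
  rw [← hN.invariant U hU 1 (one_mem _), Matrix.mul_one]
  refine le_trans ?_ (pinching_le hN _)
  have hdiag : (Matrix.of fun (i : Fin p) (j : Fin m) => if (i : ℕ) = (j : ℕ) then
      (U * (scaledColumns m x u - scaledColumns m x u')) i j else 0) =
      cornerDiag p m r fun l => x l * (1 - inner ℝ (u l) (u' l)) := by
    ext i j
    rw [cornerDiag_apply, Matrix.of_apply]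
    by_cases hij : (i : ℕ) = j
    swap
    · simp [hij]
    by_cases hir : (i : ℕ) < r
    · rw [if_pos hij, dif_pos ⟨hij, hir⟩, Matrix.mul_apply]
      have hjr : (j : ℕ) < r := hij ▸ hir
      have hl : (⟨j, hjr⟩ : Fin r) = ⟨i, hir⟩ := by simp [hij]
      have h1 : inner ℝ (u ⟨i, hir⟩) (u ⟨i, hir⟩) = (1 : ℝ) := by
        rw [real_inner_self_eq_norm_sq, hu.1, one_pow]
      rw [← h1, PiLp.inner_apply, PiLp.inner_apply, ← Finset.sum_sub_distrib, Finset.mul_sum]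
      refine Finset.sum_congr rfl fun a _ => ?_
      rw [hUu i hir, Matrix.sub_apply]
      simp only [scaledColumns, Matrix.of_apply, dif_pos hjr, hl]
      simp
      ring
    · have hjr : ¬ (j : ℕ) < r := hij ▸ hir
      rw [if_pos hij, dif_neg (by tauto), Matrix.mul_apply]
      simp [scaledColumns, hjr]
  rw [hdiag]
  refine le_trans (le_of_eq ?_) (hx _)
  congr 1
  exact Finset.sum_congr rfl fun l _ => by ring

/-! ### Signed placements of the Hartley columns -/

section Placement

variable {k q : ℕ}

/-- The sign encoded by a Boolean. -/
def boolSign (c : Bool) : ℝ := if c then 1 else -1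

/-- The `l`-th Hartley column with its `b`-th entry, signed by `(f b).2`, placed at
coordinate `e (b, (f b).1)`. -/
noncomputable def placedColumn (e : Fin k × Fin q → Fin p) (f : Fin k → Fin q × Bool)
    (l : Fin k) : EuclideanSpace ℝ (Fin p) :=
  WithLp.toLp 2 fun a => ∑ b, if e (b, (f b).1) = a then boolSign (f b).2 * hartley k b l else 0

/-- Injectivity of `e` keeps different rows `b` at different coordinates, so only rows put at the
same position by `f` and `f'` interact. -/
theorem inner_placedColumn {e : Fin k × Fin q → Fin p} (he : Function.Injective e)
    (f f' : Fin k → Fin q × Bool) (l l' : Fin k) :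
    inner ℝ (placedColumn e f l) (placedColumn e f' l') =
      ∑ b, if (f b).1 = (f' b).1 then
        boolSign (f b).2 * boolSign (f' b).2 * (hartley k b l * hartley k b l') else 0 := by
  rw [PiLp.inner_apply]
  simp only [placedColumn, RCLike.inner_apply, conj_trivial]
  simp_rw [Finset.sum_mul_sum]
  rw [Finset.sum_comm]
  refine (Finset.sum_congr rfl fun b _ => Finset.sum_comm).trans ?_
  rw [Finset.sum_comm]
  refine Finset.sum_congr rfl fun b _ => ?_
  have h : ∀ b' a, ((if e (b', (f' b').1) = a then boolSign (f' b').2 * hartley k b' l' else 0) *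
      if e (b, (f b).1) = a then boolSign (f b).2 * hartley k b l else 0) =
      if a = e (b, (f b).1) then (if b' = b ∧ (f b).1 = (f' b').1 then
        boolSign (f b).2 * boolSign (f' b').2 * (hartley k b l * hartley k b' l') else 0)
      else 0 := by
    intro b' a
    by_cases ha : a = e (b, (f b).1)
    · have h2 : e (b', (f' b').1) = a ↔ (b' = b ∧ (f b).1 = (f' b').1) := by
        rw [ha, he.eq_iff, Prod.mk.injEq, eq_comm (a := (f' b').1)]
      rw [if_pos ha.symm, if_pos ha]
      simp only [h2]
      split_ifs <;> ring
    · rw [if_neg ha, if_neg (Ne.symm ha), mul_zero]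
  simp only [h, Finset.sum_ite_eq', Finset.mem_univ, if_true, ite_and]

theorem boolSign_mul_self (c : Bool) : boolSign c * boolSign c = 1 := by
  cases c <;> norm_num [boolSign]

theorem orthonormal_placedColumn {e : Fin k × Fin q → Fin p} (he : Function.Injective e)
    (f : Fin k → Fin q × Bool) : Orthonormal ℝ (placedColumn e f) := by
  rw [orthonormal_iff_ite]
  intro l l'
  rw [inner_placedColumn he, ← sum_hartley_mul]
  simp [boolSign_mul_self]

/-- Row `b` contributes `0` where `f` and `f'` agree, `h²` where the positions differ, and `2h²`
where only the signs differ. -/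
theorem le_one_sub_inner_placedColumn {e : Fin k × Fin q → Fin p} (he : Function.Injective e)
    (f f' : Fin k → Fin q × Bool) (l : Fin k) :
    ∑ b, (if f b ≠ f' b then hartley k b l ^ 2 else 0) ≤
      1 - inner ℝ (placedColumn e f l) (placedColumn e f' l) := by
  have h1 : (1 : ℝ) = ∑ b, hartley k b l * hartley k b l := by rw [sum_hartley_mul, if_pos rfl]
  rw [inner_placedColumn he, h1, ← Finset.sum_sub_distrib]
  refine Finset.sum_le_sum fun b _ => ?_
  have hsq := mul_self_nonneg (hartley k b l)
  rcases hf : f b with ⟨a, c⟩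
  rcases hf' : f' b with ⟨a', c'⟩
  by_cases ha : a = a' <;> cases c <;> cases c' <;> simp [ha, boolSign] <;> nlinarith

theorem scaledColumns_mem_submatrixSparse {r s : ℕ} (hrk : r ≤ k) (hrs : r ≤ s) (x : Fin r → ℝ)
    (e : Fin k × Fin q → Fin p) (f : Fin k → Fin q × Bool) :
    scaledColumns m x (fun l => placedColumn e f (Fin.castLE hrk l)) ∈
      submatrixSparse k s p m := by
  refine ⟨?_, ?_⟩
  · have hsub : {i | (scaledColumns m x
        (fun l => placedColumn e f (Fin.castLE hrk l))).row i ≠ 0} ⊆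
        Set.range fun b => e (b, (f b).1) := by
      intro i hi
      by_contra hni
      refine hi ?_
      ext j
      have h0 : ∀ b, e (b, (f b).1) ≠ i := fun b hb => hni ⟨b, hb⟩
      simp [scaledColumns, placedColumn, Matrix.row, h0]
    refine (Set.ncard_le_ncard hsub (Set.toFinite _)).trans ?_
    rw [← Set.image_univ]
    exact (Set.ncard_image_le (Set.toFinite _)).trans (by simp [Set.ncard_univ])
  · have hsub : {j | (scaledColumns m x
        (fun l => placedColumn e f (Fin.castLE hrk l))).col j ≠ 0} ⊆
        {j : Fin m | (j : ℕ) < r} := by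
      intro j hj
      by_contra hnj
      refine hj ?_
      ext i
      have h0 : ¬ (j : ℕ) < r := hnj
      simp [scaledColumns, Matrix.col, h0]
    refine (Set.ncard_le_ncard hsub (Set.toFinite _)).trans (le_trans ?_ hrs)
    rw [← Set.ncard_image_of_injective _ Fin.val_injective]
    refine (Set.ncard_le_ncard (t := ((Finset.range r : Finset ℕ) : Set ℕ)) ?_
      (Set.toFinite _)).trans (by simp)
    rintro _ ⟨j, hj, rfl⟩
    simpa using hj

end Placement

/-! ### The packing -/

/-- With `q = p / k ≥ 1`, `p < k (q + 1) ≤ 2qk`; the extra `1 = log e` is at most `2 log 2`. -/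
theorem log_exp_mul_div_le {k : ℕ} (hk : 1 ≤ k) (hkp : k ≤ p) :
    Real.log (Real.exp 1 * p / k) ≤ 3 * Real.log (2 * (p / k : ℕ)) := by
  have hq : 1 ≤ p / k := (Nat.one_le_div_iff (by lia)).2 hkp
  have hk0 : (0 : ℝ) < k := by exact_mod_cast hk
  have hp0 : (0 : ℝ) < p := by exact_mod_cast hk.trans hkp
  set q := p / k
  have hQ2 : (2 : ℝ) ≤ 2 * q := by
    have : (1 : ℝ) ≤ q := by exact_mod_cast hq
    linarith
  have hpk : (p : ℝ) ≤ 2 * q * k := by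
    have h : p < k * (q + 1) := Nat.lt_mul_div_succ p (by lia)
    have h' : p ≤ 2 * q * k := by nlinarith
    exact_mod_cast h'
  have h1 : Real.log (Real.exp 1 * p / k) ≤ Real.log (Real.exp 1 * (2 * q)) := by
    refine Real.log_le_log (by positivity) ?_
    rw [div_le_iff₀ hk0]
    nlinarith [Real.exp_pos 1]
  rw [Real.log_mul (Real.exp_pos 1).ne' (by positivity), Real.log_exp] at h1
  have h2 := Real.log_le_log (by norm_num) hQ2
  have := Real.log_two_gt_d9
  linarith

theorem exists_row_packing {k s r : ℕ} (hr : 1 ≤ r) (hrk : r ≤ k) (hkp : k ≤ p) (hrs : r ≤ s)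
    (hsm : s ≤ m) {N : Seminorm ℝ (Matrix (Fin p) (Fin m) ℝ)}
    (hN : IsUnitarilyInvariantNorm N) :
    ∃ F : Finset (Matrix (Fin p) (Fin m) ℝ),
      (∀ A ∈ F, ∑ i, ∑ j, A i j ^ 2 ≤ 1 ∧ A ∈ submatrixSparse k s p m) ∧
      (∀ A ∈ F, ∀ B ∈ F, A ≠ B →
        1 / 80 * lipschitzConst (N.comp (cornerDiag p m r)) ≤ N (A - B)) ∧
      1 / 60 * (k * Real.log (Real.exp 1 * p / k)) ≤ Real.log F.card := by
  classical
  have hk : 1 ≤ k := hr.trans hrk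
  have hk0 : (0 : ℝ) < k := by exact_mod_cast hk
  set L := lipschitzConst (N.comp (cornerDiag p m r))
  have hL : 0 < L := lipschitzConst_pos hN hr (hrk.trans hkp) (hrs.trans hsm)
  obtain ⟨x, hx1, hqx, hq⟩ := exists_lipschitzConst_maximizer hr (N.comp (cornerDiag p m r))
  have hsubgrad : ∀ z : Fin r → ℝ, L * ∑ i, x i * z i ≤ N (cornerDiag p m r z) :=
    mul_dot_le_of_maximizer (N.comp (cornerDiag p m r)) hx1 hqx hq
  -- the row weights
  let w : Fin k → ℝ := fun b => ∑ l, x l ^ 2 * hartley k b (Fin.castLE hrk l) ^ 2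
  have hw0 : ∀ b, 0 ≤ w b := fun b => Finset.sum_nonneg fun _ _ => by positivity
  have hw_le : ∀ b, w b ≤ 2 / k := fun b => by
    calc w b ≤ ∑ l, x l ^ 2 * (2 / k) :=
          Finset.sum_le_sum fun l _ => mul_le_mul_of_nonneg_left (hartley_sq_le _ _) (sq_nonneg _)
      _ = 2 / k := by rw [← Finset.sum_mul, hx1, one_mul]
  have hw_sum : ∑ b, w b = 1 := by
    rw [Finset.sum_comm, ← hx1]
    refine Finset.sum_congr rfl fun l _ => ?_
    have h := sum_hartley_mul (Fin.castLE hrk l) (Fin.castLE hrk l)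
    rw [if_pos rfl] at h
    rw [← Finset.mul_sum]
    simp_rw [pow_two (hartley _ _ _)]
    rw [h, mul_one]
  let S : Finset (Fin k) := univ.filter fun b => 1 / (2 * (k : ℝ)) ≤ w b
  -- Rows outside `S` carry total weight at most `1/2`, and each row of `S` at most `2/k`.
  have hS : (k : ℝ) ≤ 4 * S.card := by
    have h1 : (1 : ℝ) ≤ S.card * (2 / k) + k * (1 / (2 * k)) := by
      calc (1 : ℝ) = ∑ b, w b := hw_sum.symm
        _ ≤ ∑ b, ((if b ∈ S then 2 / (k : ℝ) else 0) + 1 / (2 * k)) := by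
          refine Finset.sum_le_sum fun b _ => ?_
          split_ifs with hb
          · exact (hw_le b).trans (by linarith [show (0 : ℝ) ≤ 1 / (2 * k) by positivity])
          · have : ¬ 1 / (2 * (k : ℝ)) ≤ w b := by simpa [S] using hb
            linarith
        _ = _ := by
          rw [Finset.sum_add_distrib, Finset.sum_ite_mem]
          simp
    have h2 : (k : ℝ) * (1 / (2 * k)) = 1 / 2 := by field_simp
    have h3 : (S.card : ℝ) * (2 / k) * k = 2 * S.card := by field_simp
    nlinarith
  -- the code
  set n := p / k
  have hn : 1 ≤ n := (Nat.one_le_div_iff (by lia)).2 hkp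
  let e : Fin k × Fin n → Fin p := fun y =>
    Fin.castLE (Nat.mul_div_le p k) (finProdFinEquiv y)
  have he : Function.Injective e := (Fin.castLE_injective _).comp finProdFinEquiv.injective
  have hcardα : Fintype.card (Fin n × Bool) = 2 * n := by simp [mul_comm]
  obtain ⟨C, hCdist, hCcard⟩ := exists_code (ι := S) (α := Fin n × Bool) (by rw [hcardα]; lia)
  -- Rows outside `S` get one fixed symbol, so codewords differ only on heavy rows.
  let ext : (S → Fin n × Bool) → Fin k → Fin n × Bool := fun g b =>
    if h : b ∈ S then g ⟨b, h⟩ else (⟨0, hn⟩, true)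
  let A : (S → Fin n × Bool) → Matrix (Fin p) (Fin m) ℝ := fun g =>
    scaledColumns m x fun l => placedColumn e (ext g) (Fin.castLE hrk l)
  have hOrth : ∀ g, Orthonormal ℝ fun l => placedColumn e (ext g) (Fin.castLE hrk l) := fun g =>
    (orthonormal_placedColumn he (ext g)).comp _ (Fin.castLE_injective hrk)
  have hsep : ∀ g ∈ C, ∀ g' ∈ C, g ≠ g' → 1 / 80 * L ≤ N (A g - A g') := by
    intro g hg g' hg' hne
    refine le_trans ?_ (le_norm_sub_scaledColumns hN hsubgrad (hOrth g))
    rw [mul_comm]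
    refine mul_le_mul_of_nonneg_left ?_ hL.le
    have h1 : ∑ b, (if ext g b ≠ ext g' b then w b else 0) ≤
        ∑ l, x l ^ 2 * (1 - inner ℝ (placedColumn e (ext g) (Fin.castLE hrk l))
          (placedColumn e (ext g') (Fin.castLE hrk l))) := by
      calc ∑ b, (if ext g b ≠ ext g' b then w b else 0) =
          ∑ b, ∑ l, x l ^ 2 *
            (if ext g b ≠ ext g' b then hartley k b (Fin.castLE hrk l) ^ 2 else 0) := by
            refine Finset.sum_congr rfl fun b _ => ?_
            by_cases h : ext g b = ext g' b <;> simp [h, w]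
        _ = ∑ l, x l ^ 2 * ∑ b,
            (if ext g b ≠ ext g' b then hartley k b (Fin.castLE hrk l) ^ 2 else 0) := by
            rw [Finset.sum_comm]
            simp_rw [Finset.mul_sum]
        _ ≤ _ := Finset.sum_le_sum fun l _ => mul_le_mul_of_nonneg_left
            (le_one_sub_inner_placedColumn he _ _ _) (sq_nonneg _)
    refine le_trans ?_ h1
    have h2 : (hammingDist g g' : ℝ) * (1 / (2 * k)) ≤
        ∑ b, (if ext g b ≠ ext g' b then w b else 0) := by
      calc (hammingDist g g' : ℝ) * (1 / (2 * k)) =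
          ∑ b : S, (if g b ≠ g' b then 1 / (2 * (k : ℝ)) else 0) := by
            rw [← Finset.sum_filter, Finset.sum_const, nsmul_eq_mul]
            rfl
        _ ≤ ∑ b : S, (if ext g b ≠ ext g' b then w b else 0) := by
            refine Finset.sum_le_sum fun b _ => ?_
            have hb : 1 / (2 * (k : ℝ)) ≤ w b := (Finset.mem_filter.1 b.2).2
            simp only [ext, b.2, dif_pos]
            split_ifs
            · exact hb
            · exact le_rfl
        _ = ∑ b ∈ S, (if ext g b ≠ ext g' b then w b else 0) :=
            Finset.sum_coe_sort S fun b => if ext g b ≠ ext g' b then w b else 0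
        _ ≤ _ := Finset.sum_le_sum_of_subset_of_nonneg (Finset.subset_univ _) fun b _ _ => by
            split_ifs
            · exact hw0 b
            · exact le_rfl
    refine le_trans ?_ h2
    -- At least `|S|/10 ≥ k/40` disagreements, each of weight at least `1/(2k)`, give `1/80`.
    have h3 : (S.card : ℝ) ≤ 10 * hammingDist g g' := by
      have := hCdist g hg g' hg' hne
      rw [Fintype.card_coe] at this
      exact_mod_cast this
    rw [mul_one_div, le_div_iff₀ (by positivity)]
    linarith
  have hinj : Set.InjOn A C := by
    intro g hg g' hg' hA
    by_contra hne
    have := hsep g hg g' hg' hne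
    rw [hA, sub_self, map_zero] at this
    linarith
  refine ⟨C.image A, ?_, ?_, ?_⟩
  · intro B hB
    obtain ⟨g, -, rfl⟩ := Finset.mem_image.1 hB
    refine ⟨?_, scaledColumns_mem_submatrixSparse hrk hrs x e _⟩
    rw [sum_sq_scaledColumns (hrs.trans hsm) x (hOrth g), hx1]
  · intro B hB B' hB' hne
    obtain ⟨g, hg, rfl⟩ := Finset.mem_image.1 hB
    obtain ⟨g', hg', rfl⟩ := Finset.mem_image.1 hB'
    exact hsep g hg g' hg' fun h => hne (h ▸ rfl)
  · rw [Finset.card_image_of_injOn hinj]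
    have hn0 : (0 : ℝ) < 2 * n := by
      have : (1 : ℝ) ≤ n := by exact_mod_cast hn
      linarith
    rw [hcardα, Fintype.card_coe] at hCcard
    push_cast at hCcard
    have h1 := Real.log_le_log (by positivity) hCcard
    rw [Real.log_pow, Real.log_pow] at h1
    have h2 := log_exp_mul_div_le hk hkp
    have h3 : 0 ≤ Real.log (2 * (n : ℝ)) := Real.log_nonneg (by
      have : (1 : ℝ) ≤ n := by exact_mod_cast hn
      linarith)
    -- The constant is `1/60 = 1/5 · 1/4 · 1/3`: code rate, share of heavy rows, and
    -- `log_exp_mul_div_le`.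
    have h4 : (k : ℝ) * Real.log (Real.exp 1 * p / k) ≤ k * (3 * Real.log (2 * (n : ℝ))) :=
      mul_le_mul_of_nonneg_left h2 hk0.le
    have h5 := mul_le_mul_of_nonneg_right hS h3
    push_cast at h1
    linarith

/-! ### Finiteness of packing numbers, and transposition -/

section Frobenius

attribute [local instance] Matrix.frobeniusNormedAddCommGroup

theorem mem_frobeniusUnitBall {A : Matrix (Fin p) (Fin m) ℝ} :
    A ∈ frobeniusUnitBall p m ↔ ∑ i, ∑ j, A i j ^ 2 ≤ 1 := by
  have h0 : 0 ≤ ∑ i, ∑ j, A i j ^ 2 :=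
    Finset.sum_nonneg fun _ _ => Finset.sum_nonneg fun _ _ => sq_nonneg _
  have h : ‖A‖ = √(∑ i, ∑ j, A i j ^ 2) := by
    rw [Matrix.frobenius_norm_def, Real.sqrt_eq_rpow]
    simp
  change ‖A‖ ≤ 1 ↔ _
  rw [h, Real.sqrt_le_one]

end Frobenius

/-- The Frobenius ball has finite packing numbers for every seminorm. -/
theorem packingNumber_ne_top (N : Seminorm ℝ (Matrix (Fin p) (Fin m) ℝ))
    {T : Set (Matrix (Fin p) (Fin m) ℝ)} (hT : T ⊆ frobeniusUnitBall p m) {ε : ℝ} (hε : 0 < ε) :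
    packingNumber T (fun A B => N (A - B)) ε ≠ ⊤ := by
  classical
  -- The entrywise sup-norm ball is compact and contains the Frobenius ball; finitely many `N`-balls
  -- of radius `ε / 2` cover it, each holding at most one packing point.
  let N' : Seminorm ℝ (Fin p → Fin m → ℝ) := N.comp (Matrix.ofLinearEquiv ℝ).toLinearMap
  have hcont : Continuous N' := continuous_seminorm N'
  have hcomp : IsCompact (Metric.closedBall (0 : Fin p → Fin m → ℝ) 1) :=
    isCompact_closedBall 0 1
  obtain ⟨t, -, ht⟩ := hcomp.elim_nhds_subcover (fun A => {B | N' (B - A) < ε / 2})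
    fun A _ => (isOpen_lt (hcont.comp (continuous_id.sub continuous_const))
      continuous_const).mem_nhds (by simpa using half_pos hε)
  have hTball : ∀ A ∈ T, ∃ B ∈ t, N (A - Matrix.of B) < ε / 2 := by
    intro A hA
    have hA1 := mem_frobeniusUnitBall.1 (hT hA)
    have hmem : (fun i j => A i j) ∈ Metric.closedBall (0 : Fin p → Fin m → ℝ) 1 := by
      rw [mem_closedBall_zero_iff, pi_norm_le_iff_of_nonneg zero_le_one]
      intro i
      rw [pi_norm_le_iff_of_nonneg zero_le_one]
      intro j
      rw [Real.norm_eq_abs, ← sq_le_one_iff_abs_le_one]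
      calc A i j ^ 2 ≤ ∑ j, A i j ^ 2 :=
            Finset.single_le_sum (f := fun j => A i j ^ 2) (fun _ _ => sq_nonneg _)
              (Finset.mem_univ j)
        _ ≤ ∑ i, ∑ j, A i j ^ 2 :=
            Finset.single_le_sum (f := fun i => ∑ j, A i j ^ 2)
              (fun _ _ => Finset.sum_nonneg fun _ _ => sq_nonneg _) (Finset.mem_univ i)
        _ ≤ 1 := hA1
    obtain ⟨B, hB, hAB⟩ := Set.mem_iUnion₂.1 (ht hmem)
    exact ⟨B, hB, hAB⟩
  refine ne_top_of_le_ne_top (ENat.natCast_ne_top t.card) (iSup₂_le fun F hF => ?_)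
  rw [Nat.cast_le]
  choose! g hgt hg using hTball
  refine Finset.card_le_card_of_injOn g (fun A hA => hgt A (hF.1 hA)) ?_
  intro A hA B hB hAB
  by_contra hne
  have h1 : ε ≤ N (A - B) := hF.2 hA hB hne
  have h2 : N (A - Matrix.of (g A)) < ε / 2 := hg A (hF.1 hA)
  have h3 : N (B - Matrix.of (g B)) < ε / 2 := hg B (hF.1 hB)
  have h4 : N (A - B) ≤ N (A - Matrix.of (g A)) + N (B - Matrix.of (g B)) := by
    rw [show A - B = (A - Matrix.of (g A)) - (B - Matrix.of (g B)) by rw [hAB]; abel]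
    exact map_sub_le_add N _ _
  linarith

theorem log_card_le_log_packingNumber {α : Type*} {T : Set α} {ρ : α → α → ℝ} {ε : ℝ}
    (h : packingNumber T ρ ε ≠ ⊤) {F : Finset α} (hF : (F : Set α) ⊆ T)
    (hρ : (F : Set α).Pairwise fun a b => ε ≤ ρ a b) :
    Real.log F.card ≤ Real.log (packingNumber T ρ ε).toNat := by
  have hle : (F.card : ℕ∞) ≤ packingNumber T ρ ε :=
    le_iSup₂ (f := fun (F : Finset α)
      (_ : F ∈ {F : Finset α | (F : Set α) ⊆ T ∧ (F : Set α).Pairwise fun a b => ε ≤ ρ a b}) =>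
      (F.card : ℕ∞)) F ⟨hF, hρ⟩
  rw [← ENat.natCast_toNat h, Nat.cast_le] at hle
  -- An empty `F` relies on the convention `Real.log 0 = 0`.
  rcases Nat.eq_zero_or_pos F.card with h0 | h0
  · rw [h0, Nat.cast_zero, Real.log_zero]
    exact Real.log_natCast_nonneg _
  · exact Real.log_le_log (by exact_mod_cast h0) (by exact_mod_cast hle)

/-- The seminorm `A ↦ N Aᵀ`. -/
def transposeSeminorm (N : Seminorm ℝ (Matrix (Fin p) (Fin m) ℝ)) :
    Seminorm ℝ (Matrix (Fin m) (Fin p) ℝ) :=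
  N.comp (Matrix.transposeLinearEquiv (Fin m) (Fin p) ℝ ℝ).toLinearMap

theorem transposeSeminorm_apply (N : Seminorm ℝ (Matrix (Fin p) (Fin m) ℝ))
    (A : Matrix (Fin m) (Fin p) ℝ) : transposeSeminorm N A = N A.transpose := rfl

theorem IsUnitarilyInvariantNorm.transpose {N : Seminorm ℝ (Matrix (Fin p) (Fin m) ℝ)}
    (hN : IsUnitarilyInvariantNorm N) : IsUnitarilyInvariantNorm (transposeSeminorm N) where
  eq_zero_of_map_eq_zero A hA := Matrix.transpose_eq_zero.1 (hN.eq_zero_of_map_eq_zero _ hA)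
  invariant U hU V hV A := by
    have hT : ∀ {n : ℕ} {W : Matrix (Fin n) (Fin n) ℝ}, W ∈ Matrix.orthogonalGroup (Fin n) ℝ →
        W.transpose ∈ Matrix.orthogonalGroup (Fin n) ℝ := fun {n W} hW => by
      rw [Matrix.mem_orthogonalGroup_iff, Matrix.transpose_transpose]
      exact (Matrix.mem_orthogonalGroup_iff' _ _).1 hW
    rw [transposeSeminorm_apply, transposeSeminorm_apply, Matrix.transpose_mul,
      Matrix.transpose_mul, ← Matrix.mul_assoc, hN.invariant _ (hT hV) _ (hT hU)]

theorem transposeSeminorm_comp_cornerDiag (N : Seminorm ℝ (Matrix (Fin p) (Fin m) ℝ)) (r : ℕ) :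
    (transposeSeminorm N).comp (cornerDiag m p r) = N.comp (cornerDiag p m r) := by
  ext x
  rw [Seminorm.comp_apply, Seminorm.comp_apply, transposeSeminorm_apply, transpose_cornerDiag]

/-- The row packing for `A ↦ N Aᵀ`, transposed back; both norms have the same restricted gauge. -/
theorem exists_col_packing {k s r : ℕ} (hr : 1 ≤ r) (hrs : r ≤ s) (hsm : s ≤ m) (hrk : r ≤ k)
    (hkp : k ≤ p) {N : Seminorm ℝ (Matrix (Fin p) (Fin m) ℝ)}
    (hN : IsUnitarilyInvariantNorm N) :
    ∃ F : Finset (Matrix (Fin p) (Fin m) ℝ),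
      (∀ A ∈ F, ∑ i, ∑ j, A i j ^ 2 ≤ 1 ∧ A ∈ submatrixSparse k s p m) ∧
      (∀ A ∈ F, ∀ B ∈ F, A ≠ B →
        1 / 80 * lipschitzConst (N.comp (cornerDiag p m r)) ≤ N (A - B)) ∧
      1 / 60 * (s * Real.log (Real.exp 1 * m / s)) ≤ Real.log F.card := by
  classical
  obtain ⟨F, hF, hsep, hcard⟩ := exists_row_packing hr hrs hsm hrk hkp hN.transpose
  rw [transposeSeminorm_comp_cornerDiag] at hsep
  refine ⟨F.image Matrix.transpose, ?_, ?_, ?_⟩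
  · intro B hB
    obtain ⟨A, hA, rfl⟩ := Finset.mem_image.1 hB
    refine ⟨?_, (hF A hA).2.2, (hF A hA).2.1⟩
    rw [Finset.sum_comm]
    exact (hF A hA).1
  · intro B hB B' hB' hne
    obtain ⟨A, hA, rfl⟩ := Finset.mem_image.1 hB
    obtain ⟨A', hA', rfl⟩ := Finset.mem_image.1 hB'
    exact hsep A hA A' hA' fun h => hne (h ▸ rfl)
  · rwa [Finset.card_image_of_injective _ Matrix.transpose_injective]

end SubmatrixPacking

theorem lemma4p2 :
    ∃ c₁ : ℝ, 0 < c₁ ∧ ∃ c₂ : ℝ, 0 < c₂ ∧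
      ∀ (p m k s : ℕ), 1 ≤ k → k ≤ p → 1 ≤ s → s ≤ m →
        ∀ N : Seminorm ℝ (Matrix (Fin p) (Fin m) ℝ),
          SubmatrixPacking.IsUnitarilyInvariantNorm N →
          ∀ M : ℕ∞,
            M = SubmatrixPacking.packingNumber
              (SubmatrixPacking.frobeniusUnitBall p m ∩
                SubmatrixPacking.submatrixSparse k s p m)
              (fun A B => N (A - B))
              (c₁ * SubmatrixPacking.lipschitzConst
                (SubmatrixPacking.gaugeRestrict (SubmatrixPacking.gauge N) (min k s))) →
            M ≠ ⊤ ∧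
              c₂ * ((k : ℝ) * Real.log (Real.exp 1 * p / k) +
                (s : ℝ) * Real.log (Real.exp 1 * m / s)) ≤ Real.log (M.toNat : ℝ) := by
  -- `1/120` is half of `1/60`, from averaging the row and column bounds.
  refine ⟨1 / 80, by norm_num, 1 / 120, by norm_num, ?_⟩
  rintro p m k s hk hkp hs hsm N hN M rfl
  have hr : 1 ≤ min k s := le_min hk hs
  have hrk : min k s ≤ k := min_le_left k s
  have hrs : min k s ≤ s := min_le_right k s
  rw [SubmatrixPacking.gaugeRestrict_gauge]
  have hL := SubmatrixPacking.lipschitzConst_pos hN hr (hrk.trans hkp) (hrs.trans hsm)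
  have hfin := SubmatrixPacking.packingNumber_ne_top N
    (T := SubmatrixPacking.frobeniusUnitBall p m ∩ SubmatrixPacking.submatrixSparse k s p m)
    Set.inter_subset_left (mul_pos (by norm_num : (0 : ℝ) < 1 / 80) hL)
  refine ⟨hfin, ?_⟩
  obtain ⟨F, hF, hFsep, hFcard⟩ := SubmatrixPacking.exists_row_packing hr hrk hkp hrs hsm hN
  obtain ⟨G, hG, hGsep, hGcard⟩ := SubmatrixPacking.exists_col_packing hr hrs hsm hrk hkp hN
  have h1 := SubmatrixPacking.log_card_le_log_packingNumber hfin
    (fun A hA => ⟨SubmatrixPacking.mem_frobeniusUnitBall.2 (hF A hA).1, (hF A hA).2⟩)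
    (fun A hA B hB hne => hFsep A hA B hB hne)
  have h2 := SubmatrixPacking.log_card_le_log_packingNumber hfin
    (fun A hA => ⟨SubmatrixPacking.mem_frobeniusUnitBall.2 (hG A hA).1, (hG A hA).2⟩)
    (fun A hA B hB hne => hGsep A hA B hB hne)
  linarith
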